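/- Let $k$ be an algebraically closed field (of arbitrary characteristic) and let $H$ be a finite-dimensional cosemisimple Hopf algebra over $k$ (a coalgebra is cosemisimple if it is the sum of its simple subcoalgebras). Let $C$ be a left $H$-module coalgebra, that is, a $k$-coalgebra $(C,\Delta_C,\varepsilon_C)$ with a left $H$-module structure such that $\Delta_C(h\cdot c)=\Delta(h)\cdot\Delta_C(c)$ and $\varepsilon_C(h\cdot c)=\varepsilon(h)\varepsilon_C(c)$ for all $h\in H$, $c\in C$. Let $\gamma: C^*\to H^*\otimes C^*$ be the left coaction of $H^*$ on the dual algebra $C^*$ given by $\langle\gamma(a),h\otimes c\rangle=\langle a,h\cdot c\rangle$. Suppose that 1. $C$ is isomorphic, as a left $H$-module, to the left regular module $H$; and 2. the $H^*$-extension $k\subset C^*$ is left Galois, i.e. the coinvariants $\{a\in C^* : \gamma(a)=1\otimes a\}$ are exactly the scalars $k\cdot 1$, and the map $C^*\otimes_k C^*\to H^*\otimes_k C^*$, $a\otimes b\mapsto(1\otimes a)\gamma(b)$, is bijective. Then the coalgebra $C$ is cosemisimple. -/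

import Mathlib

open scoped TensorProduct

noncomputable section

namespace HopfTwist

section Coalgebras

variable {k : Type*} {C : Type*} [Field k] [AddCommGroup C] [Module k C] [Coalgebra k C]

/-- A subspace `D` of a coalgebra `C` is a subcoalgebra if `Δ(D) ⊆ D ⊗ D`, where `D ⊗ D` is
identified with its image in `C ⊗ C`. -/
def IsSubcoalgebra (D : Submodule k C) : Prop :=
  D.map (Coalgebra.comul : C →ₗ[k] C ⊗[k] C) ≤
    LinearMap.range (TensorProduct.map D.subtype D.subtype)

/-- A simple subcoalgebra: nonzero, with no subcoalgebras other than `0` and itself. -/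
def IsSimpleSubcoalgebra (D : Submodule k C) : Prop :=
  IsSubcoalgebra D ∧ D ≠ ⊥ ∧ ∀ E : Submodule k C, IsSubcoalgebra E → E ≤ D → E = ⊥ ∨ E = D

variable (k C) in
/-- The coradical: the sum of all simple subcoalgebras. -/
def coradical : Submodule k C :=
  sSup {D : Submodule k C | IsSimpleSubcoalgebra D}

variable (k C) in
/-- A coalgebra is cosemisimple if it is the sum of its simple subcoalgebras. -/
def IsCosemisimple : Prop :=
  coradical k C = ⊤

end Coalgebras

section ModuleCoalgebras

variable (k : Type*) (H : Type*) (C : Type*) [Field k] [Ring H] [HopfAlgebra k H]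
  [AddCommGroup C] [Module k C] [Module H C] [IsScalarTower k H C]

/-- The action of `H` on a module `C`, as a `k`-bilinear map `(h, c) ↦ h • c`. -/
def action : H →ₗ[k] C →ₗ[k] C :=
  (Algebra.lsmul k k C).toLinearMap

/-- A left `H`-module coalgebra: a coalgebra `C` with a left `H`-module structure such that
`Δ(h • c) = Δ(h) • Δ(c)` (componentwise action of `H ⊗ H` on `C ⊗ C`) and
`ε(h • c) = ε(h) ε(c)`. -/
class IsModuleCoalgebra [Coalgebra k C] : Prop where
  comul_smul : ∀ (h : H) (c : C),
    Coalgebra.comul (R := k) (h • c) =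
      TensorProduct.map₂ (action k H C) (action k H C)
        (Coalgebra.comul (R := k) h) (Coalgebra.comul (R := k) c)
  counit_smul : ∀ (h : H) (c : C),
    Coalgebra.counit (R := k) (h • c) =
      Coalgebra.counit (R := k) h * Coalgebra.counit (R := k) c

end ModuleCoalgebras

section Duals

variable (k : Type*) (C : Type*) [Field k] [AddCommGroup C] [Module k C] [Coalgebra k C]

/-- The dual algebra `C^*` of a coalgebra `C`: the linear forms on `C` with the convolution
product `(a * b)(c) = a(c₁) b(c₂)`, whose unit is the counit of `C`. -/
def ConvDual : Type _ := WithConv (C →ₗ[k] k)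

instance : Ring (ConvDual k C) := inferInstanceAs (Ring (WithConv (C →ₗ[k] k)))

instance : Algebra k (ConvDual k C) := inferInstanceAs (Algebra k (WithConv (C →ₗ[k] k)))

/-- The underlying vector space of the dual algebra `C^*` is the dual space of `C`. -/
def ConvDual.toDual : ConvDual k C ≃ₗ[k] Module.Dual k C where
  toFun a := WithConv.ofConv a
  invFun f := WithConv.toConv f
  map_add' _ _ := rfl
  map_smul' _ _ := rfl
  left_inv _ := rfl
  right_inv _ := rfl

theorem ConvDual.toDual_mul (a b : ConvDual k C) (c : C) :
    ConvDual.toDual k C (a * b) c =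
      LinearMap.mul' k k (TensorProduct.map (ConvDual.toDual k C a) (ConvDual.toDual k C b)
        (Coalgebra.comul (R := k) c)) :=
  rfl

theorem ConvDual.toDual_one (c : C) :
    ConvDual.toDual k C 1 c = Coalgebra.counit (R := k) c :=
  rfl

variable (H : Type*) [Ring H] [HopfAlgebra k H] [FiniteDimensional k H]

/-- The identification `H^* ⊗ C^* ≃ Hom(H, C^*)`, `f ⊗ a ↦ (h ↦ f(h) a)`, for a
finite-dimensional `H`. -/
def convDualTensorEquiv :
    ConvDual k H ⊗[k] ConvDual k C ≃ₗ[k] (H →ₗ[k] Module.Dual k C) :=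
  TensorProduct.congr (ConvDual.toDual k H) (ConvDual.toDual k C) ≪≫ₗ
    dualTensorHomEquiv k H (Module.Dual k C)

theorem convDualTensorEquiv_tmul (f : ConvDual k H) (a : ConvDual k C) (h : H) (c : C) :
    convDualTensorEquiv k C H (f ⊗ₜ a) h c = ConvDual.toDual k H f h * ConvDual.toDual k C a c := by
  simp [convDualTensorEquiv]

variable [Module H C] [IsScalarTower k H C]

/-- The left coaction `γ : C^* → H^* ⊗ C^*` dual to the left action `H ⊗ C → C`: it is determined
by `⟨γ(a), h ⊗ c⟩ = ⟨a, h • c⟩`. -/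
def dualCoaction : ConvDual k C →ₗ[k] ConvDual k H ⊗[k] ConvDual k C :=
  (convDualTensorEquiv k C H).symm.toLinearMap ∘ₗ
    { toFun := fun a => (action k H C).compr₂ (ConvDual.toDual k C a)
      map_add' := fun _ _ => rfl
      map_smul' := fun _ _ => rfl }

/-- The pairing of `γ(a)` with `h ⊗ c` is `a(h • c)`. -/
theorem convDualTensorEquiv_dualCoaction (a : ConvDual k C) (h : H) (c : C) :
    convDualTensorEquiv k C H (dualCoaction k C H a) h c = ConvDual.toDual k C a (h • c) := by
  simp only [dualCoaction, LinearMap.comp_apply, LinearEquiv.coe_coe, LinearEquiv.apply_symm_apply]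
  rfl

end Duals

section Galois

variable {k : Type*} {K : Type*} {A : Type*} [Field k] [Ring K] [Algebra k K]
  [Ring A] [Algebra k A]

/-- The coinvariants `{a | γ(a) = 1 ⊗ a}` of a left coaction `γ : A → K ⊗ A`. -/
def coinvariants (γ : A →ₗ[k] K ⊗[k] A) : Submodule k A :=
  LinearMap.eqLocus γ (TensorProduct.mk k K A 1)

/-- The canonical map `A ⊗ A → K ⊗ A`, `a ⊗ b ↦ (1 ⊗ a) γ(b)`. -/
def galoisMap (γ : A →ₗ[k] K ⊗[k] A) : A ⊗[k] A →ₗ[k] K ⊗[k] A :=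
  TensorProduct.lift
    ((LinearMap.mul k (K ⊗[k] A)).compl₁₂ (TensorProduct.mk k K A 1) γ)

/-- The extension `k ⊂ A` is left `K`-Galois: the coinvariants of the coaction `γ` are exactly the
scalars, and the canonical map `A ⊗ A → K ⊗ A` is bijective. -/
def IsLeftGaloisOverBase (γ : A →ₗ[k] K ⊗[k] A) : Prop :=
  coinvariants γ = LinearMap.range (Algebra.linearMap k A) ∧
    Function.Bijective (galoisMap γ)

end Galois

end HopfTwist

end

/-! This is Maschke's theorem for the dual algebra `C^*`, run on the coalgebra side.
Cosemisimplicity of `H` yields an integral `t` in `H^*` with `t f = f(1) t` and `t(1) = 1`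
(`exists_normalized_integral`). Let `β` be the canonical map and `e = β⁻¹(t ⊗ 1)`. Since `γ` is
multiplicative, `β((b ⊗ 1) e) = t ⊗ b` and `β(e (1 ⊗ b)) = (t ⊗ 1) γ(b) = t ⊗ b`, so `(b ⊗ 1) e = e
(1 ⊗ b)`; evaluating `β(e)` at the unit of `H` shows that `e` multiplies to `1`. Thus `e` is a
separability idempotent (`exists_separability_idempotent`).

The hit actions make `C` a `C^*`-bimodule whose sub-bimodules are the subcoalgebras. Averaging a
linear projection with `e` on each side gives a bimodule projection, so every subcoalgebra has a
complementary one (`IsSubcoalgebra.exists_isCompl`). A complement of the coradical contains no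
simple subcoalgebra, hence vanishes by finite-dimensionality. -/

open scoped TensorProduct

noncomputable section

namespace HopfTwist

/-! ### Subcoalgebras as sub-bimodules over the dual algebra -/

section Hits

variable {k C : Type*} [Field k] [AddCommGroup C] [Module k C] [Coalgebra k C]

/-- The left hit action `a ⇀ c = c₁ a(c₂)` of the dual algebra on a coalgebra. -/
def leftHit : ConvDual k C →ₗ[k] Module.End k C where
  toFun a := (TensorProduct.rid k C).toLinearMap ∘ₗ
    (ConvDual.toDual k C a).lTensor C ∘ₗ Coalgebra.comul
  map_add' a b := by ext; simp [LinearMap.lTensor_add]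
  map_smul' r a := by ext; simp [LinearMap.lTensor_smul]

/-- The right hit action `c ↼ a = a(c₁) c₂` of the dual algebra on a coalgebra. -/
def rightHit : ConvDual k C →ₗ[k] Module.End k C where
  toFun a := (TensorProduct.lid k C).toLinearMap ∘ₗ
    (ConvDual.toDual k C a).rTensor C ∘ₗ Coalgebra.comul
  map_add' a b := by ext; simp [LinearMap.rTensor_add]
  map_smul' r a := by ext; simp [LinearMap.rTensor_smul]

theorem leftHit_apply (a : ConvDual k C) (c : C) :
    leftHit a c = TensorProduct.rid k C
      ((ConvDual.toDual k C a).lTensor C (Coalgebra.comul (R := k) c)) := rfl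

theorem rightHit_apply (a : ConvDual k C) (c : C) :
    rightHit a c = TensorProduct.lid k C
      ((ConvDual.toDual k C a).rTensor C (Coalgebra.comul (R := k) c)) := rfl

theorem leftHit_one : leftHit (1 : ConvDual k C) = 1 := by
  ext c
  have h : ConvDual.toDual k C 1 = Coalgebra.counit := rfl
  rw [leftHit_apply, h, Coalgebra.lTensor_counit_comul]
  simp

theorem rightHit_one : rightHit (1 : ConvDual k C) = 1 := by
  ext c
  have h : ConvDual.toDual k C 1 = Coalgebra.counit := rfl
  rw [rightHit_apply, h, Coalgebra.rTensor_counit_comul]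
  simp

theorem leftHit_mul (a b : ConvDual k C) : leftHit (a * b) = leftHit a * leftHit b := by
  ext c
  have h₁ : ∀ u : C ⊗[k] C, TensorProduct.rid k C ((ConvDual.toDual k C (a * b)).lTensor C u) =
      TensorProduct.rid k C ((LinearMap.mul' k k ∘ₗ TensorProduct.map (ConvDual.toDual k C a)
        (ConvDual.toDual k C b)).lTensor C (Coalgebra.comul.lTensor C u)) := by
    intro u
    induction u with
    | zero => simp
    | add x y hx hy => simp only [map_add, hx, hy]
    | tmul x y => simp [ConvDual.toDual_mul]
  have h₂ : ∀ u : C ⊗[k] C,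
      leftHit a (TensorProduct.rid k C ((ConvDual.toDual k C b).lTensor C u)) =
      TensorProduct.rid k C ((LinearMap.mul' k k ∘ₗ TensorProduct.map (ConvDual.toDual k C a)
        (ConvDual.toDual k C b)).lTensor C
          (TensorProduct.assoc k C C C (Coalgebra.comul.rTensor C u))) := by
    intro u
    induction u with
    | zero => simp
    | add x y hx hy => simp only [map_add, hx, hy]
    | tmul x y =>
      simp only [LinearMap.lTensor_tmul, TensorProduct.rid_tmul, map_smul, leftHit_apply,
        LinearMap.rTensor_tmul]
      induction Coalgebra.comul (R := k) x with
      | zero => simp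
      | add x y hx hy => simp only [map_add, smul_add, TensorProduct.add_tmul, hx, hy]
      | tmul x z => simp [smul_smul, mul_comm]
  rw [Module.End.mul_apply, leftHit_apply b, h₂, Coalgebra.coassoc_apply, leftHit_apply, h₁]

theorem rightHit_mul (a b : ConvDual k C) : rightHit (a * b) = rightHit b * rightHit a := by
  ext c
  have h₁ : ∀ u : C ⊗[k] C, TensorProduct.lid k C ((ConvDual.toDual k C (a * b)).rTensor C u) =
      TensorProduct.lid k C ((LinearMap.mul' k k ∘ₗ TensorProduct.map (ConvDual.toDual k C a)
        (ConvDual.toDual k C b)).rTensor C (Coalgebra.comul.rTensor C u)) := by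
    intro u
    induction u with
    | zero => simp
    | add x y hx hy => simp only [map_add, hx, hy]
    | tmul x y => simp [ConvDual.toDual_mul]
  have h₂ : ∀ u : C ⊗[k] C,
      rightHit b (TensorProduct.lid k C ((ConvDual.toDual k C a).rTensor C u)) =
      TensorProduct.lid k C ((LinearMap.mul' k k ∘ₗ TensorProduct.map (ConvDual.toDual k C a)
        (ConvDual.toDual k C b)).rTensor C
          ((TensorProduct.assoc k C C C).symm (Coalgebra.comul.lTensor C u))) := by
    intro u
    induction u with
    | zero => simp
    | add x y hx hy => simp only [map_add, hx, hy]
    | tmul x y =>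
      simp only [LinearMap.lTensor_tmul, TensorProduct.lid_tmul, map_smul, rightHit_apply,
        LinearMap.rTensor_tmul]
      induction Coalgebra.comul (R := k) y with
      | zero => simp
      | add x y hx hy => simp only [map_add, smul_add, TensorProduct.tmul_add, hx, hy]
      | tmul x z => simp [smul_smul]
  rw [Module.End.mul_apply, rightHit_apply a, h₂, Coalgebra.coassoc_symm_apply, rightHit_apply, h₁]

/-- By coassociativity both composites send `c` to `b(c₁) a(c₃) c₂`. -/
theorem commute_leftHit_rightHit (a b : ConvDual k C) :
    Commute (leftHit a) (rightHit b) := by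
  ext c
  have h₁ : ∀ u : C ⊗[k] C,
      leftHit a (TensorProduct.lid k C ((ConvDual.toDual k C b).rTensor C u)) =
      TensorProduct.lid k C (TensorProduct.map (ConvDual.toDual k C b)
        ((TensorProduct.rid k C).toLinearMap ∘ₗ (ConvDual.toDual k C a).lTensor C)
          (Coalgebra.comul.lTensor C u)) := by
    intro u
    induction u with
    | zero => simp
    | add x y hx hy => simp only [map_add, hx, hy]
    | tmul x y => simp [leftHit_apply]
  have h₂ : ∀ u : C ⊗[k] C,
      rightHit b (TensorProduct.rid k C ((ConvDual.toDual k C a).lTensor C u)) =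
      TensorProduct.lid k C (TensorProduct.map (ConvDual.toDual k C b)
        ((TensorProduct.rid k C).toLinearMap ∘ₗ (ConvDual.toDual k C a).lTensor C)
          (TensorProduct.assoc k C C C (Coalgebra.comul.rTensor C u))) := by
    intro u
    induction u with
    | zero => simp
    | add x y hx hy => simp only [map_add, hx, hy]
    | tmul x y =>
      simp only [LinearMap.lTensor_tmul, TensorProduct.rid_tmul, map_smul, rightHit_apply,
        LinearMap.rTensor_tmul]
      induction Coalgebra.comul (R := k) x with
      | zero => simp
      | add x y hx hy => simp only [map_add, smul_add, TensorProduct.add_tmul, hx, hy]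
      | tmul x z => simp [smul_smul]
  rw [Module.End.mul_apply, Module.End.mul_apply, rightHit_apply b c, h₁, leftHit_apply a c, h₂,
    Coalgebra.coassoc_apply]

/-- Invariance of a subspace under both hit actions. -/
def IsHitInvariant (D : Submodule k C) : Prop :=
  ∀ a : ConvDual k C, ∀ c ∈ D, leftHit a c ∈ D ∧ rightHit a c ∈ D

theorem IsSubcoalgebra.isHitInvariant {D : Submodule k C} (hD : IsSubcoalgebra D) :
    IsHitInvariant D := by
  intro a c hc
  obtain ⟨u, hu⟩ := hD (Submodule.mem_map_of_mem hc)
  rw [leftHit_apply, rightHit_apply, ← hu]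
  clear hu
  induction u with
  | zero => simp
  | add x y hx hy =>
    simp only [map_add]
    exact ⟨D.add_mem hx.1 hy.1, D.add_mem hx.2 hy.2⟩
  | tmul x y =>
    simp only [TensorProduct.map_tmul, LinearMap.lTensor_tmul, LinearMap.rTensor_tmul,
      TensorProduct.rid_tmul, TensorProduct.lid_tmul]
    exact ⟨D.smul_mem _ x.2, D.smul_mem _ y.2⟩

theorem tensor_ext_right {V W : Type*} [AddCommGroup V] [Module k V] [AddCommGroup W] [Module k W]
    {u v : V ⊗[k] W}
    (h : ∀ f : Module.Dual k W, TensorProduct.rid k V (f.lTensor V u) =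
      TensorProduct.rid k V (f.lTensor V v)) : u = v := by
  let b := Module.Free.chooseBasis k W
  apply (TensorProduct.equivFinsuppOfBasisRight b).injective
  have key : ∀ (w : V ⊗[k] W) i, TensorProduct.equivFinsuppOfBasisRight b w i =
      TensorProduct.rid k V ((b.coord i).lTensor V w) := by
    intro w i
    induction w with
    | zero => simp
    | add x y hx hy => simp only [map_add, Finsupp.add_apply, hx, hy]
    | tmul x y => simp
  ext i
  rw [key, key, h]

theorem tensor_ext_left {V W : Type*} [AddCommGroup V] [Module k V] [AddCommGroup W] [Module k W]
    {u v : V ⊗[k] W}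
    (h : ∀ f : Module.Dual k V, TensorProduct.lid k W (f.rTensor W u) =
      TensorProduct.lid k W (f.rTensor W v)) : u = v := by
  let b := Module.Free.chooseBasis k V
  apply (TensorProduct.equivFinsuppOfBasisLeft b).injective
  have key : ∀ (w : V ⊗[k] W) i, TensorProduct.equivFinsuppOfBasisLeft b w i =
      TensorProduct.lid k W ((b.coord i).rTensor W w) := by
    intro w i
    induction w with
    | zero => simp
    | add x y hx hy => simp only [map_add, Finsupp.add_apply, hx, hy]
    | tmul x y => simp
  ext i
  rw [key, key, h]

/-- The hits of `c` are the slices of `Δ(c)` by linear forms. If all lie in `D`, a projection onto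
`D` applied to either leg fixes `Δ(c)`, so `Δ(c)` lies in `D ⊗ D`. -/
theorem IsHitInvariant.isSubcoalgebra {D : Submodule k C} (hD : IsHitInvariant D) :
    IsSubcoalgebra D := by
  rintro _ ⟨c, hc, rfl⟩
  obtain ⟨p, hp⟩ := D.subtype.exists_leftInverse_of_injective D.ker_subtype
  have hp' : ∀ x ∈ D, (p x : C) = x := fun x hx =>
    congrArg Subtype.val (LinearMap.congr_fun hp ⟨x, hx⟩)
  let π : Module.End k C := D.subtype ∘ₗ p
  have h₁ : π.rTensor C (Coalgebra.comul (R := k) c) = Coalgebra.comul (R := k) c := by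
    apply tensor_ext_right
    intro f
    have key : ∀ u : C ⊗[k] C, TensorProduct.rid k C (f.lTensor C (π.rTensor C u)) =
        π (TensorProduct.rid k C (f.lTensor C u)) := by
      intro u
      induction u with
      | zero => simp
      | add x y hx hy => simp only [map_add, hx, hy]
      | tmul x y => simp
    rw [key]
    exact hp' _ (hD ((ConvDual.toDual k C).symm f) c hc).1
  have h₂ : π.lTensor C (Coalgebra.comul (R := k) c) = Coalgebra.comul (R := k) c := by
    apply tensor_ext_left
    intro f
    have key : ∀ u : C ⊗[k] C, TensorProduct.lid k C (f.rTensor C (π.lTensor C u)) =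
        π (TensorProduct.lid k C (f.rTensor C u)) := by
      intro u
      induction u with
      | zero => simp
      | add x y hx hy => simp only [map_add, hx, hy]
      | tmul x y => simp
    rw [key]
    exact hp' _ (hD ((ConvDual.toDual k C).symm f) c hc).2
  refine ⟨TensorProduct.map p p (Coalgebra.comul (R := k) c), ?_⟩
  have h₃ : ∀ u : C ⊗[k] C, TensorProduct.map D.subtype D.subtype (TensorProduct.map p p u) =
      π.rTensor C (π.lTensor C u) := by
    intro u
    induction u with
    | zero => simp
    | add x y hx hy => simp only [map_add, hx, hy]
    | tmul x y => simp [π]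
  rw [h₃, h₂, h₁]

theorem IsSubcoalgebra.inf {D E : Submodule k C} (hD : IsSubcoalgebra D) (hE : IsSubcoalgebra E) :
    IsSubcoalgebra (D ⊓ E) :=
  IsHitInvariant.isSubcoalgebra fun a c hc =>
    ⟨⟨(hD.isHitInvariant a c hc.1).1, (hE.isHitInvariant a c hc.2).1⟩,
      ⟨(hD.isHitInvariant a c hc.1).2, (hE.isHitInvariant a c hc.2).2⟩⟩

theorem IsSubcoalgebra.sSup {S : Set (Submodule k C)} (hS : ∀ D ∈ S, IsSubcoalgebra D) :
    IsSubcoalgebra (sSup S) := by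
  rw [IsSubcoalgebra, Submodule.map_le_iff_le_comap]
  refine sSup_le fun D hD => ?_
  rw [← Submodule.map_le_iff_le_comap]
  refine (hS D hD).trans ?_
  rintro _ ⟨u, rfl⟩
  refine ⟨TensorProduct.map (Submodule.inclusion (le_sSup hD))
    (Submodule.inclusion (le_sSup hD)) u, ?_⟩
  rw [← LinearMap.comp_apply, ← TensorProduct.map_comp]
  rfl

theorem IsSubcoalgebra.sup {D E : Submodule k C} (hD : IsSubcoalgebra D) (hE : IsSubcoalgebra E) :
    IsSubcoalgebra (D ⊔ E) := by
  rw [← sSup_pair]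
  exact IsSubcoalgebra.sSup (by rintro _ (rfl | rfl) <;> assumption)

theorem isSubcoalgebra_bot : IsSubcoalgebra (⊥ : Submodule k C) := by
  simp [IsSubcoalgebra]

end Hits

/-! ### From an integral to a separability idempotent -/

section GaloisObjects

variable {k H C : Type*} [Field k] [Ring H] [HopfAlgebra k H]
  [AddCommGroup C] [Module k C] [Coalgebra k C]

variable (k H C) in
/-- Evaluation `f ⊗ a ↦ f(1) a` of the first factor at the unit of `H`. -/
def evalOne : ConvDual k H ⊗[k] ConvDual k C →ₗ[k] ConvDual k C :=
  (TensorProduct.lid k _).toLinearMap ∘ₗ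
    ((LinearMap.applyₗ (1 : H)) ∘ₗ (ConvDual.toDual k H).toLinearMap).rTensor _

theorem evalOne_tmul (f : ConvDual k H) (a : ConvDual k C) :
    evalOne k H C (f ⊗ₜ a) = ConvDual.toDual k H f 1 • a := by
  simp [evalOne]

theorem evalOne_one_tmul_mul (a : ConvDual k C) (x : ConvDual k H ⊗[k] ConvDual k C) :
    evalOne k H C ((1 ⊗ₜ a) * x) = a * evalOne k H C x := by
  induction x with
  | zero => simp
  | add x y hx hy => simp only [map_add, mul_add, hx, hy]
  | tmul f b => simp [evalOne_tmul]

theorem integral_tmul_one_mul {t : ConvDual k H}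
    (ht : ∀ f, t * f = ConvDual.toDual k H f 1 • t) (x : ConvDual k H ⊗[k] ConvDual k C) :
    (t ⊗ₜ 1) * x = t ⊗ₜ evalOne k H C x := by
  induction x with
  | zero => simp
  | add x y hx hy => simp only [map_add, mul_add, hx, hy, TensorProduct.tmul_add]
  | tmul f b => simp [evalOne_tmul, ht, TensorProduct.smul_tmul]

variable [FiniteDimensional k H]

theorem toDual_evalOne (x : ConvDual k H ⊗[k] ConvDual k C) :
    ConvDual.toDual k C (evalOne k H C x) = convDualTensorEquiv k C H x 1 := by
  induction x with
  | zero => simp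
  | add x y hx hy => simp only [map_add, hx, hy, LinearMap.add_apply]
  | tmul f a =>
    ext c
    simp [evalOne_tmul, convDualTensorEquiv_tmul]

theorem convDualTensorEquiv_mul (x y : ConvDual k H ⊗[k] ConvDual k C) (h : H) (c : C) :
    convDualTensorEquiv k C H (x * y) h c =
      LinearMap.mul' k k (TensorProduct.map₂ (convDualTensorEquiv k C H x)
        (convDualTensorEquiv k C H y) (Coalgebra.comul (R := k) h)
          (Coalgebra.comul (R := k) c)) := by
  induction x with
  | zero => simp [TensorProduct.map₂]
  | add x x' hx hx' =>
    simp only [add_mul, map_add, LinearMap.add_apply, hx, hx']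
    simp [TensorProduct.map₂, TensorProduct.map_add_left]
  | tmul f a =>
    induction y with
    | zero => simp [TensorProduct.map₂]
    | add y y' hy hy' =>
      simp only [mul_add, map_add, LinearMap.add_apply, hy, hy']
      simp [TensorProduct.map₂, TensorProduct.map_add_right]
    | tmul g b =>
      rw [Algebra.TensorProduct.tmul_mul_tmul, convDualTensorEquiv_tmul, ConvDual.toDual_mul,
        ConvDual.toDual_mul]
      induction Coalgebra.comul (R := k) h with
      | zero => simp
      | add u u' hu hu' => simp only [map_add, add_mul, LinearMap.add_apply, hu, hu']
      | tmul u u' =>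
        induction Coalgebra.comul (R := k) c with
        | zero => simp
        | add v v' hv hv' => simp only [map_add, mul_add, hv, hv']
        | tmul v v' =>
          simp only [TensorProduct.map_tmul, LinearMap.mul'_apply, TensorProduct.map₂_apply_tmul,
            convDualTensorEquiv_tmul]
          ring

variable [Module H C] [IsScalarTower k H C]

theorem dualCoaction_mul [IsModuleCoalgebra k H C] (a b : ConvDual k C) :
    dualCoaction k C H (a * b) = dualCoaction k C H a * dualCoaction k C H b := by
  apply (convDualTensorEquiv k C H).injective
  ext h c
  rw [convDualTensorEquiv_mul, convDualTensorEquiv_dualCoaction, ConvDual.toDual_mul,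
    IsModuleCoalgebra.comul_smul]
  induction Coalgebra.comul (R := k) h with
  | zero => simp
  | add u u' hu hu' => simp only [map_add, LinearMap.add_apply, hu, hu']
  | tmul u u' =>
    induction Coalgebra.comul (R := k) c with
    | zero => simp
    | add v v' hv hv' => simp only [map_add, hv, hv']
    | tmul v v' =>
      simp [convDualTensorEquiv_dualCoaction, action]

theorem evalOne_dualCoaction (a : ConvDual k C) : evalOne k H C (dualCoaction k C H a) = a := by
  apply (ConvDual.toDual k C).injective
  ext c
  rw [toDual_evalOne, convDualTensorEquiv_dualCoaction, one_smul]

/-- Evaluation at `1` undoes the coaction, because `1` acts trivially on `C`; this recovers the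
product of `e` from its image. -/
theorem evalOne_galoisMap (z : ConvDual k C ⊗[k] ConvDual k C) :
    evalOne k H C (galoisMap (dualCoaction k C H) z) = LinearMap.mul' k _ z := by
  induction z with
  | zero => simp
  | add x y hx hy => simp only [map_add, hx, hy]
  | tmul a b => simp [galoisMap, evalOne_one_tmul_mul, evalOne_dualCoaction]

theorem galoisMap_tmul_one_mul (b : ConvDual k C) (z : ConvDual k C ⊗[k] ConvDual k C) :
    galoisMap (dualCoaction k C H) ((b ⊗ₜ 1) * z) =
      (1 ⊗ₜ b) * galoisMap (dualCoaction k C H) z := by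
  induction z with
  | zero => simp
  | add x y hx hy => simp only [map_add, mul_add, hx, hy]
  | tmul a c => simp [galoisMap, ← mul_assoc]

theorem galoisMap_mul_one_tmul [IsModuleCoalgebra k H C] (b : ConvDual k C)
    (z : ConvDual k C ⊗[k] ConvDual k C) :
    galoisMap (dualCoaction k C H) (z * (1 ⊗ₜ b)) =
      galoisMap (dualCoaction k C H) z * dualCoaction k C H b := by
  induction z with
  | zero => simp
  | add x y hx hy => simp only [map_add, add_mul, hx, hy]
  | tmul a c => simp [galoisMap, mul_assoc, dualCoaction_mul]

/-- The preimage of a normalized integral under the canonical map is a separability idempotent. -/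
theorem exists_separability_idempotent [IsModuleCoalgebra k H C] {t : ConvDual k H}
    (ht : ∀ f, t * f = ConvDual.toDual k H f 1 • t) (ht1 : ConvDual.toDual k H t 1 = 1)
    (hgal : Function.Bijective (galoisMap (dualCoaction k C H))) :
    ∃ e : ConvDual k C ⊗[k] ConvDual k C,
      (∀ b, (b ⊗ₜ 1) * e = e * (1 ⊗ₜ b)) ∧ LinearMap.mul' k _ e = 1 := by
  -- Both sides of the centrality identity have image `t ⊗ b`, so injectivity of the canonical map
  -- identifies them.
  obtain ⟨e, he⟩ := hgal.2 (t ⊗ₜ 1)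
  refine ⟨e, fun b => hgal.1 ?_, ?_⟩
  · rw [galoisMap_tmul_one_mul, galoisMap_mul_one_tmul, he, integral_tmul_one_mul ht,
      evalOne_dualCoaction]
    simp
  · rw [← evalOne_galoisMap (H := H), he, evalOne_tmul, ht1, one_smul]

end GaloisObjects

/-! ### Normalized integrals from cosemisimplicity -/

section Integrals

variable {k H : Type*} [Field k] [Ring H] [HopfAlgebra k H]

theorem isSubcoalgebra_span_one : IsSubcoalgebra (Submodule.span k {(1 : H)}) := by
  rw [IsSubcoalgebra, Submodule.map_span_le]
  rintro _ rfl
  let o : Submodule.span k {(1 : H)} := ⟨1, Submodule.mem_span_singleton_self 1⟩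
  exact ⟨o ⊗ₜ o, by simp [o, Algebra.TensorProduct.one_def]⟩

/-- A finite-dimensional cosemisimple Hopf algebra is the sum of the line spanned by the unit and
a subcoalgebra not containing the unit. -/
theorem exists_subcoalgebra_compl_one [FiniteDimensional k H] (hH : IsCosemisimple k H) :
    ∃ D : Submodule k H, IsSubcoalgebra D ∧ 1 ∉ D ∧ Submodule.span k {(1 : H)} ⊔ D = ⊤ := by
  have : Nontrivial H := by
    refine ⟨0, 1, fun h => zero_ne_one (α := k) ?_⟩
    rw [← map_zero (Coalgebra.counit (R := k) (A := H)), h, Bialgebra.counit_one]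
  -- `D` is maximal among subcoalgebras avoiding `1`.
  obtain ⟨D, ⟨hD, h1⟩, hmax⟩ := WellFounded.has_min
    (r := ((· > ·) : Submodule k H → Submodule k H → Prop)) wellFounded_gt
    {D | IsSubcoalgebra D ∧ 1 ∉ D} ⟨⊥, isSubcoalgebra_bot, by simp⟩
  refine ⟨D, hD, h1, top_unique ?_⟩
  rw [← hH, coradical]
  refine sSup_le fun S hS => ?_
  have hS' := hS
  obtain ⟨hSsub, -, hSmin⟩ := hS
  rcases hSmin _ (hSsub.inf (isSubcoalgebra_span_one.sup hD)) inf_le_left with h | h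
  · exfalso
    by_cases hle : S ≤ D
    · have : S = ⊥ := by
        rw [← h]
        exact (inf_eq_left.2 (hle.trans le_sup_right)).symm
      exact hS'.2.1 this
    -- By maximality `1 = d + s`; then `s = 1 - d` lies in the zero intersection, forcing `1 ∈ D`.
    · refine hmax (D ⊔ S) ⟨hD.sup hSsub, fun hmem => ?_⟩ (left_lt_sup.2 hle)
      obtain ⟨d, hd, s, hs, hds⟩ := Submodule.mem_sup.1 hmem
      have hs' : s ∈ S ⊓ (Submodule.span k {(1 : H)} ⊔ D) := by
        refine ⟨hs, ?_⟩
        rw [eq_sub_of_add_eq' hds]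
        exact Submodule.sub_mem _ (le_sup_left (a := Submodule.span k {(1 : H)})
          (Submodule.mem_span_singleton_self 1)) (le_sup_right (b := D) hd)
      rw [h, Submodule.mem_bot] at hs'
      rw [hs', add_zero] at hds
      exact h1 (hds ▸ hd)
  · exact inf_eq_left.1 h

/-- A finite-dimensional cosemisimple Hopf algebra has a right integral in its dual taking the
value one at the unit. -/
theorem exists_normalized_integral [FiniteDimensional k H] (hH : IsCosemisimple k H) :
    ∃ t : ConvDual k H, (∀ f, t * f = ConvDual.toDual k H f 1 • t) ∧
      ConvDual.toDual k H t 1 = 1 := by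
  obtain ⟨D, hD, h1, htop⟩ := exists_subcoalgebra_compl_one hH
  -- The integral is a form killing `D`, rescaled to be `1` at the unit. Since `Δ(D) ⊆ D ⊗ D`, the
  -- product `t f` also kills `D`, and at `1` it equals `f(1)`.
  obtain ⟨t, ht1, htD⟩ := Submodule.exists_le_ker_of_notMem h1
  have hne : t 1 ≠ 0 := ht1
  let t' : ConvDual k H := (ConvDual.toDual k H).symm ((t 1)⁻¹ • t)
  have ht' : ConvDual.toDual k H t' = (t 1)⁻¹ • t := LinearEquiv.apply_symm_apply _ _
  have ht'1 : ConvDual.toDual k H t' 1 = 1 := by simp [ht', hne]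
  have ht'D : ∀ d ∈ D, ConvDual.toDual k H t' d = 0 := fun d hd => by
    have : t d = 0 := htD hd
    simp [ht', this]
  refine ⟨t', fun f => (ConvDual.toDual k H).injective ?_, ht'1⟩
  have hle : Submodule.span k {(1 : H)} ⊔ D ≤
      LinearMap.eqLocus (ConvDual.toDual k H (t' * f))
        (ConvDual.toDual k H (ConvDual.toDual k H f 1 • t')) := by
    refine sup_le ((Submodule.span_singleton_le_iff_mem _ _).2 ?_) fun d hd => ?_
    · rw [LinearMap.mem_eqLocus, ConvDual.toDual_mul]
      simp [ht'1, Algebra.TensorProduct.one_def]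
    · rw [LinearMap.mem_eqLocus, ConvDual.toDual_mul]
      obtain ⟨u, hu⟩ := hD (Submodule.mem_map_of_mem hd)
      have key : ∀ u : D ⊗[k] D, TensorProduct.map (ConvDual.toDual k H t')
          (ConvDual.toDual k H f) (TensorProduct.map D.subtype D.subtype u) = 0 := by
        intro u
        induction u with
        | zero => simp
        | add x y hx hy => simp only [map_add, hx, hy, add_zero]
        | tmul x y => simp [ht'D x x.2]
      rw [← hu, key]
      simp [ht'D d hd]
  rw [htop] at hle
  ext x
  exact hle (Submodule.mem_top (x := x))

end Integrals

/-! ### Averaging projections and complements -/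

section Averaging

variable {k C : Type*} [Field k] [AddCommGroup C] [Module k C] [Coalgebra k C]

theorem IsSubcoalgebra.exists_isCompl {e : ConvDual k C ⊗[k] ConvDual k C}
    (he : ∀ b, (b ⊗ₜ 1) * e = e * (1 ⊗ₜ b)) (he1 : LinearMap.mul' k _ e = 1)
    {E : Submodule k C} (hE : IsSubcoalgebra E) :
    ∃ F : Submodule k C, IsSubcoalgebra F ∧ IsCompl E F := by
  obtain ⟨n, x, y, rfl⟩ := TensorProduct.exists_sum_tmul_eq e
  simp only [Finset.mul_sum, Finset.sum_mul, Algebra.TensorProduct.tmul_mul_tmul, one_mul,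
    mul_one] at he
  rw [map_sum] at he1
  simp only [LinearMap.mul'_apply] at he1
  obtain ⟨p₀, hp₀⟩ := E.subtype.exists_leftInverse_of_injective E.ker_subtype
  let p : Module.End k C := E.subtype ∘ₗ p₀
  have hpE : ∀ c ∈ E, p c = c := fun c hc =>
    congrArg Subtype.val (LinearMap.congr_fun hp₀ ⟨c, hc⟩)
  have hpmem : ∀ c, p c ∈ E := fun c => (p₀ c).2
  have hinv := hE.isHitInvariant
  -- Averaging over the left action; centrality of `e` makes `q` left-linear.
  let q : Module.End k C := ∑ j, leftHit (x j) * p * leftHit (y j)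
  have hqE : ∀ c ∈ E, q c = c := fun c hc => by
    simp only [q, LinearMap.sum_apply, Module.End.mul_apply]
    simp_rw [fun j => hpE _ (hinv (y j) c hc).1, ← Module.End.mul_apply, ← leftHit_mul]
    rw [← LinearMap.sum_apply, ← map_sum, he1, leftHit_one, Module.End.one_apply]
  have hqmem : ∀ c, q c ∈ E := fun c => by
    simp only [q, LinearMap.sum_apply, Module.End.mul_apply]
    exact Submodule.sum_mem _ fun j _ => (hinv _ _ (hpmem _)).1
  have hqcomm : ∀ b, Commute (leftHit b) q := fun b => by
    have := congrArg (TensorProduct.lift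
      (((LinearMap.mul k (Module.End k C)).compl₁₂
        (LinearMap.mulRight k p ∘ₗ leftHit) leftHit))) (he b)
    simpa [Commute, SemiconjBy, q, Finset.mul_sum, Finset.sum_mul, leftHit_mul, mul_assoc]
      using this
  -- The right hit reverses products, so the legs of `e` swap places. Left-linearity of `q` survives
  -- because the two actions commute.
  let r : Module.End k C := ∑ j, rightHit (y j) * q * rightHit (x j)
  have hrE : ∀ c ∈ E, r c = c := fun c hc => by
    simp only [r, LinearMap.sum_apply, Module.End.mul_apply]
    simp_rw [fun j => hqE _ (hinv (x j) c hc).2, ← Module.End.mul_apply, ← rightHit_mul]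
    rw [← LinearMap.sum_apply, ← map_sum, he1, rightHit_one, Module.End.one_apply]
  have hrmem : ∀ c, r c ∈ E := fun c => by
    simp only [r, LinearMap.sum_apply, Module.End.mul_apply]
    exact Submodule.sum_mem _ fun j _ => (hinv _ _ (hqmem _)).2
  have hrright : ∀ b, Commute (rightHit b) r := fun b => by
    have := congrArg (TensorProduct.lift
      ((LinearMap.mul k (Module.End k C)).flip.compl₁₂
        rightHit (LinearMap.mulRight k q ∘ₗ rightHit))) (he b)
    simpa [Commute, SemiconjBy, r, Finset.mul_sum, Finset.sum_mul, rightHit_mul, mul_assoc]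
      using this.symm
  have hrleft : ∀ b, Commute (leftHit b) r := fun b =>
    Commute.sum_right _ _ _ fun j _ =>
      ((commute_leftHit_rightHit _ _).mul_right (hqcomm b)).mul_right
        (commute_leftHit_rightHit _ _)
  refine ⟨LinearMap.ker r, IsHitInvariant.isSubcoalgebra fun a c hc => ?_, ?_⟩
  · rw [LinearMap.mem_ker] at hc
    constructor
    · rw [LinearMap.mem_ker, ← Module.End.mul_apply, ← (hrleft a).eq, Module.End.mul_apply, hc,
        map_zero]
    · rw [LinearMap.mem_ker, ← Module.End.mul_apply, ← (hrright a).eq, Module.End.mul_apply, hc,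
        map_zero]
  · refine ⟨Submodule.disjoint_def.2 fun c hc hc' => ?_, codisjoint_iff.2 (top_unique ?_)⟩
    · rw [← hrE c hc]
      exact hc'
    · intro c _
      refine Submodule.mem_sup.2 ⟨r c, hrmem c, c - r c, ?_, add_sub_cancel _ _⟩
      rw [LinearMap.mem_ker, map_sub, hrE _ (hrmem c), sub_self]

/-- A finite-dimensional coalgebra whose dual algebra has a separability idempotent is
cosemisimple. -/
theorem isCosemisimple_of_separability_idempotent [FiniteDimensional k C]
    {e : ConvDual k C ⊗[k] ConvDual k C}
    (he : ∀ b, (b ⊗ₜ 1) * e = e * (1 ⊗ₜ b)) (he1 : LinearMap.mul' k _ e = 1) :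
    IsCosemisimple k C := by
  have hR : IsSubcoalgebra (coradical k C) := IsSubcoalgebra.sSup fun D hD => hD.1
  obtain ⟨F, hF, hcompl⟩ := hR.exists_isCompl he he1
  suffices hbot : F = ⊥ by
    simpa [hbot, IsCosemisimple] using hcompl.sup_eq_top
  by_contra hne
  -- A minimal nonzero subcoalgebra of `F` is simple, so it lies in both the coradical and its
  -- complement.
  obtain ⟨S, ⟨hS, hS0, hSF⟩, hmin⟩ := WellFounded.has_min
    (r := ((· < ·) : Submodule k C → Submodule k C → Prop)) wellFounded_lt
    {S | IsSubcoalgebra S ∧ S ≠ ⊥ ∧ S ≤ F} ⟨F, hF, hne, le_rfl⟩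
  have hsimple : IsSimpleSubcoalgebra S := by
    refine ⟨hS, hS0, fun E hE hES => or_iff_not_imp_left.2 fun hE0 => ?_⟩
    exact hES.eq_of_not_lt (hmin E ⟨hE, hE0, hES.trans hSF⟩)
  exact hS0 (le_bot_iff.1 (hcompl.disjoint (le_sSup hsimple) hSF))

end Averaging

end HopfTwist

end

theorem mainTheorem10 {k : Type*} [Field k] [IsAlgClosed k]
    {H : Type*} [Ring H] [HopfAlgebra k H] [FiniteDimensional k H]
    (hH : HopfTwist.IsCosemisimple k H)
    {C : Type*} [AddCommGroup C] [Module k C] [Coalgebra k C]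
    [Module H C] [IsScalarTower k H C] [HopfTwist.IsModuleCoalgebra k H C]
    (hreg : Nonempty (C ≃ₗ[H] H))
    (hgal : HopfTwist.IsLeftGaloisOverBase (HopfTwist.dualCoaction k C H)) :
    HopfTwist.IsCosemisimple k C := by
  obtain ⟨φ⟩ := hreg
  have : FiniteDimensional k C := Module.Finite.equiv (φ.restrictScalars k).symm
  obtain ⟨t, ht, ht1⟩ := HopfTwist.exists_normalized_integral hH
  obtain ⟨e, he, he1⟩ := HopfTwist.exists_separability_idempotent ht ht1 hgal.2
  exact HopfTwist.isCosemisimple_of_separability_idempotent he he1
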